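/- Let $\kappa=(\kappa_0,\dots,\kappa_4)\in\mathbb{C}^5$ satisfy $2\kappa_0+\kappa_1+\kappa_2+\kappa_3+\kappa_4=1$, and let $\mathrm{P}_{\mathrm{VI}}(\kappa)$ be the Hamiltonian system $\frac{dq}{dz}=\frac{\partial H}{\partial p}$, $\frac{dp}{dz}=-\frac{\partial H}{\partial q}$ with $$z(z-1)H = q(q-1)(q-z)\,p^2-\{\kappa_1(q-1)(q-z)+(\kappa_2-1)\,q(q-1)+\kappa_3\,q(q-z)\}\,p+\kappa_0(\kappa_0+\kappa_4)(q-z).$$ For an integer $n\ge 1$, an (algebraic) $n$-branch solution germ around $z=0$ is a multivalued solution $(q(z),p(z))$ on a punctured disk around $z=0$ whose lift under $z=\zeta^n$ is single-valued and meromorphic at $\zeta=0$, and for which $n$ is the exact number of branches, i.e. the least positive number of turns around $z=0$ that brings the germ back to itself. Then for every integer $n>1$ there exist $\varphi(n)$ mutually disjoint one-parameter families of $n$-branch solution germs of $\mathrm{P}_{\mathrm{VI}}(\kappa)$ around $z=0$, indexed by the $\varphi(n)$ integers $m$ with $0<m<n$ and $\gcd(m,n)=1$, each with parameter $t\in\mathbb{C}^{\times}=\mathbb{C}\setminus\{0\}$,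 given by convergent Puiseux(–Laurent) series $$q(z)=t\,z^{m/n}+\sum_{\nu=m+1}^{\infty}a_\nu(n,m,t;\kappa)\,z^{\nu/n},\qquad p(z)=\frac{m+n(\kappa_1+\kappa_2-1)}{2nt}\,z^{-m/n}+\sum_{\nu=-m+1}^{\infty}b_\nu(n,m,t;\kappa)\,z^{\nu/n}.$$ Here "one-parameter family" means that distinct values of $t$ give distinct germs and that the lift $(q,p)$, as a function of $(t,\zeta)$ with $\zeta=z^{1/n}$, is jointly holomorphic for $\zeta\neq 0$ small, locally uniformly in $t\in\mathbb{C}^{\times}$; "mutually disjoint" means that for $m\ne m'$ no branch of a member of the $m$-th family coincides, as a germ at $\zeta=0$, with a branch of a member of the $m'$-th family. -/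

import Mathlib

open Filter Topology

namespace PainleveVI

/-- The parameter space: the affine hyperplane `2κ₀ + κ₁ + κ₂ + κ₃ + κ₄ = 1` of `ℂ⁵`. -/
def parameterSpace : Set (Fin 5 → ℂ) :=
  {κ | 2 * κ 0 + κ 1 + κ 2 + κ 3 + κ 4 = 1}

/-- The Hamiltonian `H(q, p, z; κ)` of the sixth Painlevé equation (for `z ≠ 0, 1`). -/
noncomputable def hamiltonian (κ : Fin 5 → ℂ) (q p z : ℂ) : ℂ :=
  (q * (q - 1) * (q - z) * p ^ 2
    - (κ 1 * (q - 1) * (q - z) + (κ 2 - 1) * q * (q - 1) + κ 3 * q * (q - z)) * p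
    + κ 0 * (κ 0 + κ 4) * (q - z)) / (z * (z - 1))

/-- `(q, p)` is a holomorphic solution on `U` of the Hamiltonian system
`dq/dz = ∂H/∂p`, `dp/dz = -∂H/∂q`. -/
def IsSolutionOn (κ : Fin 5 → ℂ) (U : Set ℂ) (q p : ℂ → ℂ) : Prop :=
  ∀ z ∈ U,
    HasDerivAt q (deriv (fun y => hamiltonian κ (q z) y z) (p z)) z ∧
    HasDerivAt p (-deriv (fun x => hamiltonian κ x (p z) z) (q z)) z

/-- Rotation of the variable `ζ = z ^ (1/n)` caused by `j` turns of `z` around `0`. -/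
noncomputable def turn (n j : ℕ) (ζ : ℂ) : ℂ :=
  Complex.exp (2 * Real.pi * Complex.I * j / n) * ζ

/-- Germs, at the puncture `ζ = 0`, of pairs of functions of `ζ`. -/
abbrev LiftGerm : Type := Germ (𝓝[≠] (0 : ℂ)) (ℂ × ℂ)

/-- The germ of the `j`-th branch `ζ ↦ F (e ^ (2πij/n) ζ)` of the lift `F`. -/
noncomputable def branchGerm (n j : ℕ) (F : ℂ → ℂ × ℂ) : LiftGerm :=
  ((fun ζ => F (turn n j ζ) : ℂ → ℂ × ℂ) : LiftGerm)

/-- `F` is the lift, under `z = ζ ^ n`, of an (algebraic) `n`-branch solution germ around `z = 0`: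
both components are meromorphic at `ζ = 0`; on some punctured disk `0 < |z| < r` every
holomorphic branch `s` of `z ^ (1/n)` gives a solution `F ∘ s` of the system; and `n` is the exact
number of branches, that is, `n` is the least positive number of turns around `z = 0` that
brings the germ back to itself. -/
def IsBranchSolutionGerm (κ : Fin 5 → ℂ) (n : ℕ) (F : ℂ → ℂ × ℂ) : Prop :=
  MeromorphicAt (fun ζ => (F ζ).1) 0 ∧
  MeromorphicAt (fun ζ => (F ζ).2) 0 ∧
  (∃ r : ℝ, 0 < r ∧ r ≤ 1 ∧
    ∀ U : Set ℂ, IsOpen U → (∀ z ∈ U, 0 < ‖z‖ ∧ ‖z‖ < r) →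
      ∀ s : ℂ → ℂ, DifferentiableOn ℂ s U → (∀ z ∈ U, s z ^ n = z) →
        IsSolutionOn κ U (fun z => (F (s z)).1) (fun z => (F (s z)).2)) ∧
  ∀ j : ℕ, 0 < j → j < n → branchGerm n j F ≠ branchGerm n 0 F

/-- The integers `0 < m < n` coprime to `n`. -/
def branchIndices (n : ℕ) : Finset ℕ :=
  (Finset.Ioo 0 n).filter fun m => Nat.Coprime m n

/-- All germs (of all branches) of the members `F t`, `t ∈ ℂ^×`, of a family. -/
def familyGerms (n : ℕ) (F : ℂ → ℂ → ℂ × ℂ) : Set LiftGerm :=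
  {g | ∃ t : ℂ, t ≠ 0 ∧ ∃ j : ℕ, g = branchGerm n j (F t)}

/-- A one-parameter family, with parameter `t ∈ ℂ^×`: distinct parameters give distinct germs, and
the lift depends holomorphically on `(t, ζ)` jointly, with a radius in `ζ` that is locally uniform
in `t`. -/
def IsOneParameterFamily (n : ℕ) (F : ℂ → ℂ → ℂ × ℂ) : Prop :=
  Set.InjOn (fun t => branchGerm n 0 (F t)) {t : ℂ | t ≠ 0} ∧
  ∀ t₀ : ℂ, t₀ ≠ 0 → ∃ ρ : ℝ, 0 < ρ ∧
    DifferentiableOn ℂ (fun x : ℂ × ℂ => F x.1 x.2)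
      {x | ‖x.1 - t₀‖ < ρ ∧ 0 < ‖x.2‖ ∧ ‖x.2‖ < ρ}

end PainleveVI

/-!
# Algebraic branches of the sixth Painlevé equation at the origin

Put `z = ζ ^ n`, `q = ζ ^ m u`, `p = ζ ^ (-m) v` and `c = (m + n (κ₁ + κ₂ - 1)) / (2 n)`. For
`0 < m < n` the Hamiltonian system becomes
`ζ u' = 2 n u (u v - c) + ζ f(ζ, u, v)`, `ζ v' = - 2 n v (u v - c) + ζ g(ζ, u, v)`
with `f`, `g` holomorphic for `|ζ| < 1` (`rescaledDerivP_eq`, `rescaledDerivQ_eq`). The equilibria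
at `ζ = 0` that matter form the curve `u v = c`, parametrized by `t = u(0) ≠ 0`, and the
linearization there is nilpotent, so that there are no resonances. Concretely, the singular terms
cancel in the equation for `u v`; hence in terms of `X = (u v - c) / ζ` the system reads
`u' = 2 n u X + f`, `v' = - 2 n v X + g`, `(ζ X)' = f v + u g`,
with initial values `u(0) = t`, `v(0) = c / t`.

Systems of the form `Y' = P(ζ, Y, X)`, `(ζ X)' = Q(ζ, Y)` are solved by Picard iteration
(`exists_holomorphic_flow`): `X` is the radial mean of `Q(ζ, Y)`, and `Y` is a fixed point of an
integral operator that contracts on small disks. The iterates are jointly holomorphic in the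
initial value and in `ζ`, and uniform convergence passes this on to the limit; both facts rest on
the Cauchy estimate for holomorphic maps between normed spaces. This gives the families and their
holomorphic dependence on `t`, and the Taylor series of `u` and `v` are the Puiseux series.

The leading term `t ζ ^ m` of `q` decides the rest: turning multiplies it by `e ^ (2πijm/n)`, which
is not `1` for `0 < j < n` because `m` is coprime to `n`, and equal germs have the same `m` and the
same leading coefficient (`eq_of_branchGerm_eq`).
-/

namespace PainleveVI

/-! ### Holomorphic maps between normed spaces -/

section BanachHolomorphy

open Metric

variable {E F : Type*} [NormedAddCommGroup E] [NormedSpace ℂ E]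
  [NormedAddCommGroup F] [NormedSpace ℂ F]

/-- The Cauchy estimate for the Fréchet derivative at the centre of a ball, obtained by restriction to
complex lines. -/
theorem norm_fderiv_le_of_forall_mem_ball {f : E → F} {x : E} {r C : ℝ} (hr : 0 < r)
    (hf : DifferentiableOn ℂ f (ball x r)) (hC : ∀ y ∈ ball x r, ‖f y‖ ≤ C) :
    ‖fderiv ℂ f x‖ ≤ 2 * C / r := by
  have hC0 : 0 ≤ C := (norm_nonneg _).trans (hC x (mem_ball_self hr))
  refine ContinuousLinearMap.opNorm_le_bound _ (by positivity) fun v => ?_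
  rcases eq_or_ne v 0 with rfl | hv
  · simp
  have hv' : 0 < ‖v‖ := norm_pos_iff.2 hv
  set R : ℝ := r / (2 * ‖v‖) with hR
  have hR0 : 0 < R := by positivity
  have hRv : R * ‖v‖ < r := by
    rw [hR, div_mul_eq_mul_div, div_lt_iff₀ (by positivity)]
    nlinarith [mul_pos hr hv']
  have hmem : ∀ s ∈ closedBall (0 : ℂ) R, x + s • v ∈ ball x r := fun s hs => by
    rw [mem_closedBall_zero_iff] at hs
    rw [mem_ball_iff_norm, add_sub_cancel_left, norm_smul]
    exact (mul_le_mul_of_nonneg_right hs hv'.le).trans_lt hRv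
  have hline : ∀ s : ℂ, HasDerivAt (fun s : ℂ => x + s • v) v s := fun s => by
    simpa using ((hasDerivAt_id s).smul_const v).const_add x
  have hd : ∀ s ∈ closedBall (0 : ℂ) R,
      DifferentiableAt ℂ (fun s : ℂ => f (x + s • v)) s := fun s hs =>
    ((hf _ (hmem s hs)).differentiableAt (isOpen_ball.mem_nhds (hmem s hs))).comp s
      (hline s).differentiableAt
  have key := Complex.norm_deriv_le_of_forall_mem_sphere_norm_le (c := (0 : ℂ))
    (f := fun s : ℂ => f (x + s • v)) (C := C) hR0
    (DifferentiableOn.diffContOnCl (by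
      rw [closure_ball _ hR0.ne']
      exact fun s hs => (hd s hs).differentiableWithinAt))
    (fun s hs => hC _ (hmem s (sphere_subset_closedBall hs)))
  have hfx : HasFDerivAt f (fderiv ℂ f x) (x + (0 : ℂ) • v) := by
    simpa using ((hf x (mem_ball_self hr)).differentiableAt
      (isOpen_ball.mem_nhds (mem_ball_self hr))).hasFDerivAt
  have hder : deriv (fun s : ℂ => f (x + s • v)) 0 = fderiv ℂ f x v :=
    (hfx.comp_hasDerivAt (0 : ℂ) (hline 0)).deriv
  rw [hder] at key
  refine key.trans (le_of_eq ?_)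
  rw [hR]
  field_simp

/-- A holomorphic function on an open subset of a normed space is continuously differentiable:
by the Cauchy estimate it is locally Lipschitz, and the Cauchy estimate for the difference of two
translates bounds the variation of the derivative. -/
theorem continuousAt_fderiv_of_differentiableOn {f : E → F} {s : Set E} (hs : IsOpen s)
    (hf : DifferentiableOn ℂ f s) {x : E} (hx : x ∈ s) : ContinuousAt (fderiv ℂ f) x := by
  obtain ⟨r, hr, hrs, hb⟩ : ∃ r : ℝ, 0 < r ∧ ball x (4 * r) ⊆ s ∧
      ∀ y ∈ ball x (4 * r), ‖f y‖ ≤ ‖f x‖ + 1 := by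
    have hc : ∀ᶠ y in 𝓝 x, ‖f y‖ < ‖f x‖ + 1 :=
      ((hf x hx).differentiableAt (hs.mem_nhds hx)).continuousAt.norm.eventually_lt
        continuousAt_const (by linarith)
    obtain ⟨r, hr, h⟩ := Metric.mem_nhds_iff.1 (inter_mem (hs.mem_nhds hx) hc)
    refine ⟨r / 4, by positivity, fun y hy => ?_, fun y hy => ?_⟩
    · exact (h (by convert hy using 2; ring)).1
    · exact (show ‖f y‖ < _ from (h (by convert hy using 2; ring)).2).le
  set C : ℝ := ‖f x‖ + 1
  have hdiff : ∀ y ∈ ball x (4 * r), DifferentiableAt ℂ f y := fun y hy =>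
    (hf y (hrs hy)).differentiableAt (hs.mem_nhds (hrs hy))
  have hsub : ∀ y ∈ ball x (3 * r), ball y r ⊆ ball x (4 * r) := fun y hy =>
    ball_subset_ball' (by rw [mem_ball] at hy; linarith)
  have hfd : ∀ y ∈ ball x (3 * r), ‖fderiv ℂ f y‖ ≤ 2 * C / r := fun y hy =>
    norm_fderiv_le_of_forall_mem_ball hr
      (fun w hw => (hdiff w (hsub y hy hw)).differentiableWithinAt)
      (fun w hw => hb w (hsub y hy hw))
  -- the radii `4 r`, `3 r`, `r` leave room for translates and for balls of radius `r`
  have hlip : ∀ y ∈ ball x (3 * r), ∀ w ∈ ball x (3 * r), ‖f w - f y‖ ≤ 2 * C / r * ‖w - y‖ :=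
    fun y hy w hw => (convex_ball x (3 * r)).norm_image_sub_le_of_norm_fderiv_le
      (fun z hz => hdiff z (ball_subset_ball (by linarith) hz)) hfd hy hw
  have hvar : ∀ y ∈ ball x r, ‖fderiv ℂ f y - fderiv ℂ f x‖ ≤
      2 * (2 * C / r * ‖y - x‖) / r := fun y hy => by
    have hyr : ‖y - x‖ < r := mem_ball_iff_norm.1 hy
    have hm : ∀ w ∈ ball x r, w + (y - x) ∈ ball x (3 * r) := fun w hw => by
      rw [mem_ball_iff_norm] at hw ⊢
      calc ‖w + (y - x) - x‖ = ‖(w - x) + (y - x)‖ := by congr 1; abel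
        _ ≤ ‖w - x‖ + ‖y - x‖ := norm_add_le _ _
        _ < 3 * r := by linarith
    have h3 : ∀ w ∈ ball x r, w ∈ ball x (3 * r) := fun w hw =>
      ball_subset_ball (by linarith) hw
    have h4 : ∀ w ∈ ball x (3 * r), w ∈ ball x (4 * r) := fun w hw =>
      ball_subset_ball (by linarith) hw
    have hx0 : x ∈ ball x r := mem_ball_self hr
    have htr : ∀ w ∈ ball x r, HasFDerivAt (fun w => f (w + (y - x)) - f w)
        (fderiv ℂ f (w + (y - x)) - fderiv ℂ f w) w := fun w hw => by
      have h1 := (hdiff _ (h4 _ (hm w hw))).hasFDerivAt.comp w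
        ((hasFDerivAt_id w).add_const (y - x))
      exact h1.sub (hdiff _ (h4 _ (h3 w hw))).hasFDerivAt
    have := norm_fderiv_le_of_forall_mem_ball hr (C := 2 * C / r * ‖y - x‖)
      (fun w hw => (htr w hw).differentiableAt.differentiableWithinAt)
      (fun w hw => by simpa using hlip w (h3 w hw) _ (hm w hw))
    rw [(htr x hx0).fderiv] at this
    simpa using this
  refine tendsto_iff_norm_sub_tendsto_zero.2 ?_
  refine squeeze_zero' (Eventually.of_forall fun _ => norm_nonneg _)
    (eventually_of_mem (ball_mem_nhds x hr) hvar) ?_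
  have : Continuous fun y : E => 2 * (2 * C / r * ‖y - x‖) / r := by fun_prop
  simpa using this.tendsto x

theorem hasStrictFDerivAt_of_differentiableOn {f : E → F} {s : Set E} (hs : IsOpen s)
    (hf : DifferentiableOn ℂ f s) {x : E} (hx : x ∈ s) :
    HasStrictFDerivAt f (fderiv ℂ f x) x :=
  hasStrictFDerivAt_of_hasFDerivAt_of_continuousAt
    (eventually_of_mem (hs.mem_nhds hx) fun y hy =>
      ((hf y hy).differentiableAt (hs.mem_nhds hy)).hasFDerivAt)
    (continuousAt_fderiv_of_differentiableOn hs hf hx)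

/-- Weierstrass' theorem in normed spaces: a uniform limit of holomorphic functions on an open set
is holomorphic. The Cauchy estimate makes the derivatives a uniform Cauchy sequence near each
point. -/
theorem differentiableOn_of_tendstoUniformlyOn [CompleteSpace F] {f : ℕ → E → F} {g : E → F}
    {s : Set E} (hs : IsOpen s) (hf : ∀ k, DifferentiableOn ℂ (f k) s)
    (hfg : TendstoUniformlyOn f g atTop s) : DifferentiableOn ℂ g s := by
  intro x hx
  obtain ⟨r, hr, hrs⟩ := Metric.isOpen_iff.1 hs x hx
  have hr2 : 0 < r / 2 := by positivity
  have hball : ∀ y ∈ ball x (r / 2), ball y (r / 2) ⊆ s := fun y hy =>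
    (ball_subset_ball' (by rw [mem_ball] at hy; linarith)).trans hrs
  have hd : ∀ k, ∀ y ∈ s, HasFDerivAt (f k) (fderiv ℂ (f k) y) y := fun k y hy =>
    ((hf k y hy).differentiableAt (hs.mem_nhds hy)).hasFDerivAt
  have hCauchy : UniformCauchySeqOn (fun k => fderiv ℂ (f k)) atTop (ball x (r / 2)) := by
    rw [Metric.uniformCauchySeqOn_iff]
    intro ε hε
    obtain ⟨N, hN⟩ := Metric.uniformCauchySeqOn_iff.1 hfg.uniformCauchySeqOn
      (ε * r / 8) (by positivity)
    refine ⟨N, fun i hi j hj y hy => ?_⟩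
    rw [dist_eq_norm]
    have hys : y ∈ s := hball y hy (mem_ball_self hr2)
    have := norm_fderiv_le_of_forall_mem_ball (f := f i - f j) (x := y) (C := ε * r / 8) hr2
      (((hf i).sub (hf j)).mono (hball y hy))
      (fun w hw => by
        have := (hN i hi j hj w (hball y hy hw)).le
        rwa [dist_eq_norm] at this)
    rw [((hd i y hys).sub (hd j y hys)).fderiv] at this
    refine this.trans_lt ?_
    rw [div_lt_iff₀ hr2]
    nlinarith [mul_pos hε hr]
  have hlim : ∀ y ∈ ball x (r / 2), ∃ L, Tendsto (fun k => fderiv ℂ (f k) y) atTop (𝓝 L) :=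
    fun y hy => cauchySeq_tendsto_of_complete (hCauchy.cauchySeq hy)
  choose! g' hg' using hlim
  exact (hasFDerivAt_of_tendstoUniformlyOn isOpen_ball
    (hCauchy.tendstoUniformlyOn_of_tendsto hg')
    (fun k y hy => hd k y (hball y hy (mem_ball_self hr2)))
    (fun y hy => hfg.tendsto_at (hball y hy (mem_ball_self hr2)))
    (mem_ball_self hr2)).differentiableAt.differentiableWithinAt

end BanachHolomorphy

/-! ### Means along radii -/

section RadialAverage

open Metric

variable {E F : Type*} [NormedAddCommGroup E] [NormedSpace ℂ E]
  [NormedAddCommGroup F] [NormedSpace ℂ F]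

/-- The mean of `g` over the segment from `0` to `ζ`; for `ζ ≠ 0` it is `ζ⁻¹ ∫₀^ζ g`. -/
noncomputable def radialAverage (g : ℂ → F) (ζ : ℂ) : F :=
  ∫ s in (0 : ℝ)..1, g (s * ζ)

theorem norm_ofReal_mul_le {s : ℝ} (hs : s ∈ Set.uIcc (0 : ℝ) 1) (ζ : ℂ) :
    ‖(s : ℂ) * ζ‖ ≤ ‖ζ‖ := by
  rw [Set.uIcc_of_le zero_le_one] at hs
  rw [norm_mul, Complex.norm_real, Real.norm_of_nonneg hs.1]
  exact mul_le_of_le_one_left (norm_nonneg _) hs.2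

theorem ofReal_mul_mem_ball {s r : ℝ} (hs : s ∈ Set.uIcc (0 : ℝ) 1) {ζ : ℂ}
    (hζ : ζ ∈ ball (0 : ℂ) r) : (s : ℂ) * ζ ∈ ball (0 : ℂ) r := by
  rw [mem_ball_zero_iff] at hζ ⊢
  exact (norm_ofReal_mul_le hs ζ).trans_lt hζ

theorem continuousOn_comp_ofReal_mul {α : Type*} [TopologicalSpace α] {g : ℂ → α} {r : ℝ}
    (hg : ContinuousOn g (ball 0 r)) {ζ : ℂ} (hζ : ζ ∈ ball (0 : ℂ) r) :
    ContinuousOn (fun s : ℝ => g (s * ζ)) (Set.uIcc 0 1) :=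
  hg.comp (by fun_prop) fun _ hs => ofReal_mul_mem_ball hs hζ

theorem norm_radialAverage_sub_le {g h : ℂ → F} {r C : ℝ} (hg : ContinuousOn g (ball 0 r))
    (hh : ContinuousOn h (ball 0 r)) (hC : ∀ w ∈ ball (0 : ℂ) r, ‖g w - h w‖ ≤ C)
    {ζ : ℂ} (hζ : ζ ∈ ball (0 : ℂ) r) :
    ‖radialAverage g ζ - radialAverage h ζ‖ ≤ C := by
  rw [radialAverage, radialAverage, ← intervalIntegral.integral_sub
    (continuousOn_comp_ofReal_mul hg hζ).intervalIntegrable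
    (continuousOn_comp_ofReal_mul hh hζ).intervalIntegrable]
  simpa using intervalIntegral.norm_integral_le_of_norm_le_const (a := 0) (b := 1)
    (f := fun s : ℝ => g (s * ζ) - h (s * ζ)) (C := C)
    fun s hs => hC _ (ofReal_mul_mem_ball (Set.uIoc_subset_uIcc hs) hζ)

theorem radialAverage_const [CompleteSpace F] (c : F) (ζ : ℂ) :
    radialAverage (fun _ => c) ζ = c := by
  simp [radialAverage]

/-- `ζ • radialAverage g ζ` is the primitive of `g` that vanishes at `0`. -/
theorem hasDerivAt_smul_radialAverage [CompleteSpace F] {g : ℂ → F} {r : ℝ}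
    (hg : DifferentiableOn ℂ g (ball 0 r)) {ζ : ℂ} (hζ : ζ ∈ ball (0 : ℂ) r) :
    HasDerivAt (fun ζ => ζ • radialAverage g ζ) (g ζ) ζ := by
  obtain ⟨G, hG⟩ := hg.isExactOn_ball
  have key : ∀ w ∈ ball (0 : ℂ) r, w • radialAverage g w = G w - G 0 := fun w hw => by
    have hd : ∀ s ∈ Set.uIcc (0 : ℝ) 1,
        HasDerivAt (fun s : ℝ => G (s * w)) (w • g (s * w)) s := fun s hs => by
      have h1 : HasDerivAt (fun s : ℝ => (s : ℂ) * w) w s := by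
        simpa using (Complex.ofRealCLM.hasDerivAt (x := s)).mul_const w
      exact (hG _ (ofReal_mul_mem_ball hs hw)).scomp s h1
    have := intervalIntegral.integral_eq_sub_of_hasDerivAt hd
      ((continuousOn_comp_ofReal_mul hg.continuousOn hw).const_smul w).intervalIntegrable
    rw [radialAverage, ← intervalIntegral.integral_smul, this]
    simp
  exact ((hG ζ hζ).sub_const (G 0)).congr_of_eventuallyEq
    (eventually_of_mem (isOpen_ball.mem_nhds hζ) key)

/-- The radial average is holomorphic jointly in the variable and in a parameter. -/
theorem differentiableOn_radialAverage {g : E × ℂ → F} {U : Set E} {r : ℝ}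
    (hU : IsOpen U) (hg : DifferentiableOn ℂ g (U ×ˢ ball 0 r)) :
    DifferentiableOn ℂ (fun x : E × ℂ => radialAverage (fun w => g (x.1, w)) x.2)
      (U ×ˢ ball 0 r) := by
  have hΩ : IsOpen (U ×ˢ ball (0 : ℂ) r) := hU.prod isOpen_ball
  rintro x₀ hx₀
  -- the map `(x, ζ) ↦ (x, s ζ)`
  let L : ℝ → (E × ℂ) →L[ℂ] (E × ℂ) := fun s =>
    (ContinuousLinearMap.fst ℂ E ℂ).prod ((s : ℂ) • ContinuousLinearMap.snd ℂ E ℂ)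
  have hLc : Continuous L := by
    have : L = fun s : ℝ => (ContinuousLinearMap.fst ℂ E ℂ).prod 0 +
        (s : ℂ) • (0 : (E × ℂ) →L[ℂ] E).prod (ContinuousLinearMap.snd ℂ E ℂ) := by
      ext s x <;> simp [L]
    rw [this]
    fun_prop
  have hL : ∀ s x, L s x = (x.1, (s : ℂ) * x.2) := fun s x => rfl
  have hLmem : ∀ s ∈ Set.uIcc (0 : ℝ) 1, ∀ x ∈ U ×ˢ ball (0 : ℂ) r,
      L s x ∈ U ×ˢ ball (0 : ℂ) r := fun s hs x hx => ⟨hx.1, ofReal_mul_mem_ball hs hx.2⟩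
  let g' : E × ℂ → ℝ → (E × ℂ) →L[ℂ] F := fun x s => (fderiv ℂ g (L s x)).comp (L s)
  have hjoint : Continuous fun y : (E × ℂ) × ℝ => L y.2 y.1 :=
    (hLc.comp continuous_snd).clm_apply continuous_fst
  have hg'c : ∀ x ∈ U ×ˢ ball (0 : ℂ) r, ∀ s ∈ Set.uIcc (0 : ℝ) 1,
      ContinuousAt (fun y : (E × ℂ) × ℝ => g' y.1 y.2) (x, s) := fun x hx s hs => by
    have h1 : ContinuousAt (fun y : (E × ℂ) × ℝ => fderiv ℂ g (L y.2 y.1)) (x, s) :=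
      ContinuousAt.comp (f := fun y : (E × ℂ) × ℝ => L y.2 y.1) (g := fderiv ℂ g)
        (continuousAt_fderiv_of_differentiableOn hΩ hg (hLmem s hs x hx)) hjoint.continuousAt
    exact h1.clm_comp (hLc.comp continuous_snd).continuousAt
  have hg'c' : ∀ x ∈ U ×ˢ ball (0 : ℂ) r, ContinuousOn (g' x) (Set.uIcc 0 1) :=
    fun x hx s hs => ((hg'c x hx s hs).comp (f := fun s : ℝ => (x, s))
      (by fun_prop)).continuousWithinAt
  obtain ⟨C, hC⟩ := isCompact_uIcc.exists_bound_of_continuousOn (hg'c' x₀ hx₀)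
  have hev : ∀ᶠ x in 𝓝 x₀, ∀ s ∈ Set.uIcc (0 : ℝ) 1, ‖g' x s‖ ≤ C + 1 := by
    refine isCompact_uIcc.eventually_forall_of_forall_eventually fun s hs => ?_
    filter_upwards [(hg'c x₀ hx₀ s hs).norm.eventually_lt
      (continuousAt_const (y := C + 1)) (by linarith [hC s hs])] with y hy using hy.le
  have hcont : ∀ x ∈ U ×ˢ ball (0 : ℂ) r,
      ContinuousOn (fun s : ℝ => g (x.1, (s : ℂ) * x.2)) (Set.uIcc 0 1) := fun x hx =>
    hg.continuousOn.comp (by fun_prop) fun s hs => hLmem s hs x hx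
  have hmem := hΩ.mem_nhds hx₀
  refine (intervalIntegral.hasFDerivAt_integral_of_dominated_of_fderiv_le
    (F := fun (x : E × ℂ) (s : ℝ) => g (x.1, (s : ℂ) * x.2)) (F' := g')
    (bound := fun _ => C + 1) (inter_mem hmem hev) ?_ (hcont x₀ hx₀).intervalIntegrable ?_ ?_
    intervalIntegrable_const ?_).differentiableAt.differentiableWithinAt
  · filter_upwards [hmem] with x hx
    exact ((hcont x hx).mono Set.uIoc_subset_uIcc).aestronglyMeasurable measurableSet_uIoc
  · exact ((hg'c' x₀ hx₀).mono Set.uIoc_subset_uIcc).aestronglyMeasurable measurableSet_uIoc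
  · exact Eventually.of_forall fun s hs x hx => hx.2 s (Set.uIoc_subset_uIcc hs)
  · refine Eventually.of_forall fun s hs x hx => ?_
    have hm := hLmem s (Set.uIoc_subset_uIcc hs) x hx.1
    exact ((hg _ hm).differentiableAt (hΩ.mem_nhds hm)).hasFDerivAt.comp x (L s).hasFDerivAt

end RadialAverage

/-! ### A singular initial value problem of Briot–Bouquet type -/

section BriotBouquet

open Metric

variable {E₁ E₂ : Type*} [NormedAddCommGroup E₁] [NormedSpace ℂ E₁]
  [NormedAddCommGroup E₂] [NormedSpace ℂ E₂]

/-- The solution `X` of `(ζ X)' = Q(ζ, Y)` that is regular at `0`, for a given function `Y`. -/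
noncomputable def fuchsPart (Q : ℂ × E₁ → E₂) (Y : ℂ → E₁) : ℂ → E₂ :=
  radialAverage fun w => Q (w, Y w)

/-- The right-hand side `P(ζ, Y, X)` with `X` replaced by the solution of `(ζ X)' = Q(ζ, Y)`
that is regular at `0`. -/
noncomputable def reducedField (P : ℂ × E₁ × E₂ → E₁) (Q : ℂ × E₁ → E₂) (Y : ℂ → E₁)
    (w : ℂ) : E₁ :=
  P (w, Y w, fuchsPart Q Y w)

/-- Picard iterates, started from the constant `y`, for the system `Y' = P(ζ, Y, X)`,
`(ζ X)' = Q(ζ, Y)`, `Y(0) = y`. -/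
noncomputable def picardIterate (P : ℂ × E₁ × E₂ → E₁) (Q : ℂ × E₁ → E₂) :
    ℕ → E₁ → ℂ → E₁
  | 0, y, _ => y
  | k + 1, y, ζ => y + ζ • radialAverage (reducedField P Q (picardIterate P Q k y)) ζ

variable {P : ℂ × E₁ × E₂ → E₁} {Q : ℂ × E₁ → E₂}

theorem differentiableOn_fuchsPart
    (hQ : DifferentiableOn ℂ Q (ball 0 1 ×ˢ Set.univ)) {U : Set E₁} (hU : IsOpen U) {r : ℝ}
    (hr : r ≤ 1) {Y : E₁ → ℂ → E₁}
    (hY : DifferentiableOn ℂ (fun x : E₁ × ℂ => Y x.1 x.2) (U ×ˢ ball 0 r)) :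
    DifferentiableOn ℂ (fun x : E₁ × ℂ => fuchsPart Q (Y x.1) x.2) (U ×ˢ ball 0 r) :=
  differentiableOn_radialAverage (g := fun x : E₁ × ℂ => Q (x.2, Y x.1 x.2)) hU
    (hQ.comp (differentiableOn_snd.prodMk hY)
      fun _ hx => ⟨ball_subset_ball hr hx.2, Set.mem_univ _⟩)

theorem differentiableOn_reducedField
    (hP : DifferentiableOn ℂ P (ball 0 1 ×ˢ Set.univ))
    (hQ : DifferentiableOn ℂ Q (ball 0 1 ×ˢ Set.univ)) {U : Set E₁} (hU : IsOpen U) {r : ℝ}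
    (hr : r ≤ 1) {Y : E₁ → ℂ → E₁}
    (hY : DifferentiableOn ℂ (fun x : E₁ × ℂ => Y x.1 x.2) (U ×ˢ ball 0 r)) :
    DifferentiableOn ℂ (fun x : E₁ × ℂ => reducedField P Q (Y x.1) x.2) (U ×ˢ ball 0 r) :=
  hP.comp (differentiableOn_snd.prodMk (hY.prodMk (differentiableOn_fuchsPart hQ hU hr hY)))
    fun _ hx => ⟨ball_subset_ball hr hx.2, Set.mem_univ _⟩

theorem differentiableOn_picardIterate
    (hP : DifferentiableOn ℂ P (ball 0 1 ×ˢ Set.univ))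
    (hQ : DifferentiableOn ℂ Q (ball 0 1 ×ˢ Set.univ)) (k : ℕ) :
    DifferentiableOn ℂ (fun x : E₁ × ℂ => picardIterate P Q k x.1 x.2)
      (Set.univ ×ˢ ball 0 1) := by
  induction k with
  | zero => exact differentiableOn_fst
  | succ k ih =>
    exact differentiableOn_fst.add (differentiableOn_snd.smul
      (differentiableOn_radialAverage
        (g := fun x : E₁ × ℂ => reducedField P Q (picardIterate P Q k x.1) x.2) isOpen_univ
        (differentiableOn_reducedField hP hQ isOpen_univ le_rfl ih)))

/-- Restriction of joint holomorphy to a slice with fixed initial value. -/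
theorem differentiableOn_slice {F : Type*} [NormedAddCommGroup F] [NormedSpace ℂ F]
    {Y : E₁ → ℂ → F} {U : Set E₁} {V : Set ℂ}
    (hY : DifferentiableOn ℂ (fun x : E₁ × ℂ => Y x.1 x.2) (U ×ˢ V)) {y : E₁} (hy : y ∈ U) :
    DifferentiableOn ℂ (Y y) V :=
  hY.comp (f := fun w : ℂ => (y, w)) (by fun_prop) fun _ hw => ⟨hy, hw⟩

/-- Near any initial value the reduced field is bounded and Lipschitz in the unknown function,
for the supremum norm on small disks. Near `(0, y)` the value `X` stays close to `Q(0, y)`, so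
only the local Lipschitz constants of `P` and `Q` enter. -/
theorem exists_reducedField_bounds [CompleteSpace E₂]
    (hP : DifferentiableOn ℂ P (ball 0 1 ×ˢ Set.univ))
    (hQ : DifferentiableOn ℂ Q (ball 0 1 ×ˢ Set.univ)) (y₀ : E₁) :
    ∃ r K M : ℝ, 0 < r ∧ r ≤ 1 ∧ 0 ≤ K ∧ 0 ≤ M ∧ ∀ ρ ≤ r, ∀ Y : ℂ → E₁,
      DifferentiableOn ℂ Y (ball 0 ρ) → (∀ w ∈ ball (0 : ℂ) ρ, Y w ∈ closedBall y₀ r) →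
      (∀ w ∈ ball (0 : ℂ) ρ, ‖reducedField P Q Y w‖ ≤ M) ∧
      ∀ Z : ℂ → E₁, DifferentiableOn ℂ Z (ball 0 ρ) →
        (∀ w ∈ ball (0 : ℂ) ρ, Z w ∈ closedBall y₀ r) →
        ∀ D : ℝ, (∀ w ∈ ball (0 : ℂ) ρ, ‖Y w - Z w‖ ≤ D) → ∀ w ∈ ball (0 : ℂ) ρ,
          ‖fuchsPart Q Y w - fuchsPart Q Z w‖ ≤ K * D ∧
          ‖reducedField P Q Y w - reducedField P Q Z w‖ ≤ K * D := by
  set x₀ : E₂ := Q (0, y₀) with hx₀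
  have h01 : (0 : ℂ) ∈ ball (0 : ℂ) 1 := mem_ball_self one_pos
  have hPs := hasStrictFDerivAt_of_differentiableOn (isOpen_ball.prod isOpen_univ) hP
    (x := (0, y₀, x₀)) ⟨h01, Set.mem_univ _⟩
  have hQs := hasStrictFDerivAt_of_differentiableOn (isOpen_ball.prod isOpen_univ) hQ
    (x := (0, y₀)) ⟨h01, Set.mem_univ _⟩
  obtain ⟨KP, sP, hsP, hlP⟩ := hPs.exists_lipschitzOnWith
  obtain ⟨KQ, sQ, hsQ, hlQ⟩ := hQs.exists_lipschitzOnWith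
  set M : ℝ := ‖P (0, y₀, x₀)‖ + 1 with hM
  have hPM : ∀ᶠ a in 𝓝 ((0 : ℂ), y₀, x₀), ‖P a‖ < M :=
    hPs.continuousAt.norm.eventually_lt continuousAt_const (by rw [hM]; linarith)
  obtain ⟨δ, hδ, hδs⟩ := Metric.mem_nhds_iff.1 (inter_mem hsP hPM)
  have hQδ : ∀ᶠ a in 𝓝 ((0 : ℂ), y₀), Q a ∈ ball x₀ (δ / 2) :=
    hQs.continuousAt.eventually (ball_mem_nhds _ (by positivity))
  obtain ⟨η, hη, hηs⟩ := Metric.mem_nhds_iff.1 (inter_mem hsQ hQδ)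
  obtain ⟨r, hr, hr1, hrδ, hrη⟩ : ∃ r : ℝ, 0 < r ∧ r ≤ 1 ∧ r < δ ∧ r < η := by
    refine ⟨min 1 (min (δ / 2) (η / 2)), by positivity, min_le_left _ _, ?_, ?_⟩
    · exact ((min_le_right _ _).trans (min_le_left _ _)).trans_lt (by linarith)
    · exact ((min_le_right _ _).trans (min_le_right _ _)).trans_lt (by linarith)
  refine ⟨r, (KP + 1) * (KQ + 1), M, hr, hr1, by positivity, by positivity, fun ρ hρ Y hY hYr => ?_⟩
  have hQmem : ∀ Y : ℂ → E₁, (∀ w ∈ ball (0 : ℂ) ρ, Y w ∈ closedBall y₀ r) →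
      ∀ w ∈ ball (0 : ℂ) ρ, (w, Y w) ∈ sQ ∧ Q (w, Y w) ∈ ball x₀ (δ / 2) :=
    fun Y hY w hw => by
      have : (w, Y w) ∈ ball ((0 : ℂ), y₀) η := by
        rw [← ball_prod_same]
        exact ⟨ball_subset_ball (hρ.trans hrη.le) hw, closedBall_subset_ball hrη (hY w hw)⟩
      exact hηs this
  have hQc : ∀ Y : ℂ → E₁, DifferentiableOn ℂ Y (ball 0 ρ) →
      ContinuousOn (fun w => Q (w, Y w)) (ball 0 ρ) := fun Y hY =>
    hQ.continuousOn.comp (continuousOn_id.prodMk hY.continuousOn)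
      fun w hw => ⟨ball_subset_ball (hρ.trans hr1) hw, Set.mem_univ _⟩
  have hPmem : ∀ Y : ℂ → E₁, DifferentiableOn ℂ Y (ball 0 ρ) →
      (∀ w ∈ ball (0 : ℂ) ρ, Y w ∈ closedBall y₀ r) → ∀ w ∈ ball (0 : ℂ) ρ,
      (w, Y w, fuchsPart Q Y w) ∈ sP ∧ ‖P (w, Y w, fuchsPart Q Y w)‖ < M :=
    fun Y hY hYr w hw => by
      have hX : ‖fuchsPart Q Y w - x₀‖ ≤ δ / 2 := by
        have := norm_radialAverage_sub_le (hQc Y hY) (continuousOn_const (c := x₀))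
          (fun v hv => (mem_ball_iff_norm.1 (hQmem Y hYr v hv).2).le) hw
        rwa [radialAverage_const] at this
      have : (w, Y w, fuchsPart Q Y w) ∈ ball ((0 : ℂ), y₀, x₀) δ := by
        rw [← ball_prod_same, ← ball_prod_same]
        exact ⟨ball_subset_ball (hρ.trans hrδ.le) hw, closedBall_subset_ball hrδ (hYr w hw),
          mem_ball_iff_norm.2 (hX.trans_lt (by linarith))⟩
      exact hδs this
  refine ⟨fun w hw => (hPmem Y hY hYr w hw).2.le, fun Z hZ hZr D hD w hw => ?_⟩
  have hD0 : 0 ≤ D := (norm_nonneg _).trans (hD w hw)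
  have hX : ‖fuchsPart Q Y w - fuchsPart Q Z w‖ ≤ KQ * D :=
    norm_radialAverage_sub_le (hQc Y hY) (hQc Z hZ) (fun v hv => by
      refine (hlQ.norm_sub_le (hQmem Y hYr v hv).1 (hQmem Z hZr v hv).1).trans ?_
      gcongr
      simpa [Prod.norm_def] using hD v hv) hw
  have hKP : (0 : ℝ) ≤ KP := KP.2
  have hKQ : (0 : ℝ) ≤ KQ := KQ.2
  have hKD := mul_nonneg hKP hD0
  have hKD' := mul_nonneg hKQ hD0
  have hKKD := mul_nonneg hKP hKD'
  refine ⟨hX.trans (by nlinarith), ?_⟩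
  refine (hlP.norm_sub_le (hPmem Y hY hYr w hw).1 (hPmem Z hZ hZr w hw).1).trans ?_
  have : ‖(w, Y w, fuchsPart Q Y w) - (w, Z w, fuchsPart Q Z w)‖ ≤ (KQ + 1) * D := by
    simp only [Prod.norm_def, Prod.fst_sub, Prod.snd_sub, sub_self, norm_zero]
    refine max_le (by positivity) (max_le ((hD w hw).trans (by nlinarith))
      (hX.trans (by nlinarith)))
  calc (KP : ℝ) * _ ≤ KP * ((KQ + 1) * D) := by gcongr
    _ ≤ (KP + 1) * (KQ + 1) * D := by nlinarith

/-- A singular initial value problem of Briot–Bouquet type: the system `Y' = P(ζ, Y, X)`,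
`(ζ X)' = Q(ζ, Y)`, `Y(0) = y` has solutions `Y`, `X` holomorphic at `ζ = 0`, which depend
holomorphically on the initial value `y`, on a disk locally uniform in `y`. The Picard iterates do
not depend on any choice of disk, hence neither does their limit. -/
theorem exists_holomorphic_flow [CompleteSpace E₁] [CompleteSpace E₂]
    (hP : DifferentiableOn ℂ P (ball 0 1 ×ˢ Set.univ))
    (hQ : DifferentiableOn ℂ Q (ball 0 1 ×ˢ Set.univ)) :
    ∃ (Y : E₁ → ℂ → E₁) (X : E₁ → ℂ → E₂), ∀ y₀ : E₁, ∃ ρ : ℝ, 0 < ρ ∧ ρ ≤ 1 ∧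
      DifferentiableOn ℂ (fun x : E₁ × ℂ => Y x.1 x.2) (ball y₀ ρ ×ˢ ball 0 ρ) ∧
      DifferentiableOn ℂ (fun x : E₁ × ℂ => X x.1 x.2) (ball y₀ ρ ×ˢ ball 0 ρ) ∧
      ∀ y ∈ ball y₀ ρ, Y y 0 = y ∧ ∀ ζ ∈ ball (0 : ℂ) ρ,
        HasDerivAt (Y y) (P (ζ, Y y ζ, X y ζ)) ζ ∧
        HasDerivAt (fun ζ => ζ • X y ζ) (Q (ζ, Y y ζ)) ζ := by
  let Y : E₁ → ℂ → E₁ := fun y ζ => limUnder atTop fun k => picardIterate P Q k y ζ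
  refine ⟨Y, fun y => fuchsPart Q (Y y), fun y₀ => ?_⟩
  obtain ⟨r, K, M, hr, hr1, hK, hM, hb⟩ := exists_reducedField_bounds hP hQ y₀
  -- `ρ M ≤ r / 2` keeps the iterates in the ball of radius `r`, `ρ K ≤ 1 / 2` makes them contract
  obtain ⟨ρ, hρ, hρr, hρM, hρK⟩ : ∃ ρ : ℝ, 0 < ρ ∧ ρ ≤ r / 2 ∧ ρ * M ≤ r / 2 ∧ ρ * K ≤ 1 / 2 := by
    refine ⟨min (r / 2) (min (r / 2 / (M + 1)) (1 / 2 / (K + 1))), by positivity,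
      min_le_left _ _, ?_, ?_⟩
    · calc _ ≤ r / 2 / (M + 1) * (M + 1) := by
            gcongr
            · exact (min_le_right _ _).trans (min_le_left _ _)
            · linarith
        _ = r / 2 := by field_simp
    · calc _ ≤ 1 / 2 / (K + 1) * (K + 1) := by
            gcongr
            · exact (min_le_right _ _).trans (min_le_right _ _)
            · linarith
        _ = 1 / 2 := by field_simp
  have hρr' : ρ ≤ r := by linarith
  have hρ1 : ρ ≤ 1 := hρr'.trans hr1
  have hball1 : ball (0 : ℂ) ρ ⊆ ball 0 1 := ball_subset_ball hρ1
  have hdk : ∀ k y, DifferentiableOn ℂ (picardIterate P Q k y) (ball 0 1) := fun k y =>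
    differentiableOn_slice (differentiableOn_picardIterate hP hQ k) (Set.mem_univ y)
  have hRk : ∀ k y, DifferentiableOn ℂ (reducedField P Q (picardIterate P Q k y)) (ball 0 1) :=
    fun k y => differentiableOn_slice (Y := fun y => reducedField P Q (picardIterate P Q k y))
      (differentiableOn_reducedField hP hQ isOpen_univ le_rfl
        (differentiableOn_picardIterate hP hQ k)) (Set.mem_univ y)
  have hsmall : ∀ {w : ℂ}, w ∈ ball (0 : ℂ) ρ → ∀ {v : E₁} {C : ℝ}, ‖v‖ ≤ C →
      ‖w • v‖ ≤ ρ * C := fun {w} hw {v C} hv => by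
    rw [norm_smul]
    exact mul_le_mul (mem_ball_zero_iff.1 hw).le hv (norm_nonneg _) hρ.le
  -- the mean of a function bounded by `C` is bounded by `C`
  have hmean : ∀ k y C, (∀ w ∈ ball (0 : ℂ) ρ,
      ‖reducedField P Q (picardIterate P Q k y) w‖ ≤ C) → ∀ w ∈ ball (0 : ℂ) ρ,
      ‖radialAverage (reducedField P Q (picardIterate P Q k y)) w‖ ≤ C := fun k y C hC w hw => by
    have := norm_radialAverage_sub_le ((hRk k y).continuousOn.mono hball1)
      (continuousOn_const (c := (0 : E₁))) (fun v hv => by simpa using hC v hv) hw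
    simpa [radialAverage_const] using this
  have hmem : ∀ k, ∀ y ∈ ball y₀ ρ, ∀ w ∈ ball (0 : ℂ) ρ,
      picardIterate P Q k y w ∈ closedBall y₀ r := by
    intro k
    induction k with
    | zero => exact fun y hy w hw => ball_subset_closedBall (ball_subset_ball hρr' hy)
    | succ k ih =>
      intro y hy w hw
      have h1 := hsmall hw (hmean k y M
        (hb ρ hρr' _ ((hdk k y).mono hball1) (ih y hy)).1 w hw)
      have h2 : ‖y - y₀‖ < ρ := mem_ball_iff_norm.1 hy
      rw [mem_closedBall_iff_norm, picardIterate, add_sub_right_comm]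
      exact (norm_add_le _ _).trans (by linarith)
  have hstep : ∀ k, ∀ y ∈ ball y₀ ρ, ∀ w ∈ ball (0 : ℂ) ρ,
      ‖picardIterate P Q k y w - picardIterate P Q (k + 1) y w‖ ≤ r / 2 / 2 ^ k := by
    intro k
    induction k with
    | zero =>
      intro y hy w hw
      have h1 := hsmall hw (hmean 0 y M
        (hb ρ hρr' _ ((hdk 0 y).mono hball1) (hmem 0 y hy)).1 w hw)
      rw [norm_sub_rev]
      simpa [picardIterate] using h1.trans hρM
    | succ k ih =>
      intro y hy w hw
      have h1 := norm_radialAverage_sub_le ((hRk k y).continuousOn.mono hball1)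
        ((hRk (k + 1) y).continuousOn.mono hball1)
        (fun v hv => ((hb ρ hρr' _ ((hdk k y).mono hball1) (hmem k y hy)).2 _
          ((hdk (k + 1) y).mono hball1) (hmem (k + 1) y hy) _ (ih y hy) v hv).2) hw
      have h2 := hsmall hw h1
      rw [smul_sub] at h2
      rw [picardIterate, picardIterate, add_sub_add_left_eq_sub]
      refine h2.trans ?_
      have h3 : 0 ≤ r / 2 / 2 ^ k := by positivity
      calc ρ * (K * (r / 2 / 2 ^ k)) = ρ * K * (r / 2 / 2 ^ k) := by ring
        _ ≤ 1 / 2 * (r / 2 / 2 ^ k) := by gcongr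
        _ = r / 2 / 2 ^ (k + 1) := by rw [pow_succ]; field_simp
  have htend : ∀ y ∈ ball y₀ ρ, ∀ w ∈ ball (0 : ℂ) ρ,
      Tendsto (fun k => picardIterate P Q k y w) atTop (𝓝 (Y y w)) := fun y hy w hw =>
    (cauchySeq_of_le_geometric_two fun k => by
      rw [dist_eq_norm]; exact hstep k y hy w hw).tendsto_limUnder
  have hclose : ∀ k, ∀ y ∈ ball y₀ ρ, ∀ w ∈ ball (0 : ℂ) ρ,
      ‖picardIterate P Q k y w - Y y w‖ ≤ r / 2 ^ k := fun k y hy w hw => by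
    rw [← dist_eq_norm]
    exact dist_le_of_le_geometric_two_of_tendsto (fun k => by
      rw [dist_eq_norm]; exact hstep k y hy w hw) (htend y hy w hw) k
  have hgeom : ∀ C : ℝ, Tendsto (fun k : ℕ => C * (r / 2 ^ k)) atTop (𝓝 0) := fun C => by
    have := (tendsto_pow_atTop_nhds_zero_of_lt_one (r := (1 / 2 : ℝ)) (by norm_num)
      (by norm_num)).const_mul (C * r)
    rw [mul_zero] at this
    refine this.congr fun k => ?_
    rw [one_div, inv_pow]
    ring
  have hYd : DifferentiableOn ℂ (fun x : E₁ × ℂ => Y x.1 x.2) (ball y₀ ρ ×ˢ ball 0 ρ) := by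
    refine differentiableOn_of_tendstoUniformlyOn (isOpen_ball.prod isOpen_ball)
      (f := fun k (x : E₁ × ℂ) => picardIterate P Q k x.1 x.2)
      (fun k => (differentiableOn_picardIterate hP hQ k).mono
        (Set.prod_mono (Set.subset_univ _) hball1)) ?_
    rw [Metric.tendstoUniformlyOn_iff]
    intro ε hε
    filter_upwards [(hgeom 1).eventually (gt_mem_nhds hε)] with k hk x hx
    rw [dist_comm, dist_eq_norm]
    exact (hclose k x.1 hx.1 x.2 hx.2).trans_lt (by simpa using hk)
  have hXd := differentiableOn_fuchsPart hQ isOpen_ball hρ1 hYd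
  refine ⟨ρ, hρ, hρ1, hYd, hXd, fun y hy => ⟨?_, fun ζ hζ => ⟨?_, ?_⟩⟩⟩
  · refine tendsto_nhds_unique (htend y hy 0 (mem_ball_self hρ))
      (tendsto_const_nhds.congr fun k => ?_)
    cases k <;> simp [picardIterate]
  · have hYy := differentiableOn_slice hYd hy
    have hYmem : ∀ w ∈ ball (0 : ℂ) ρ, Y y w ∈ closedBall y₀ r := fun w hw =>
      isClosed_closedBall.mem_of_tendsto (htend y hy w hw)
        (Eventually.of_forall fun k => hmem k y hy w hw)
    refine hasDerivAt_of_tendstoUniformlyOn (l := atTop) (s := ball (0 : ℂ) ρ)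
      (f := fun k => picardIterate P Q (k + 1) y)
      (f' := fun k => reducedField P Q (picardIterate P Q k y))
      (g' := reducedField P Q (Y y)) isOpen_ball ?_ ?_ ?_ hζ
    · rw [Metric.tendstoUniformlyOn_iff]
      intro ε hε
      filter_upwards [(hgeom K).eventually (gt_mem_nhds hε)] with k hk w hw
      rw [dist_comm, dist_eq_norm]
      exact ((hb ρ hρr' _ ((hdk k y).mono hball1) (hmem k y hy)).2 _ hYy hYmem _
        (hclose k y hy) w hw).2.trans_lt hk
    · exact Eventually.of_forall fun k w hw =>
        (hasDerivAt_smul_radialAverage (hRk k y) (hball1 hw)).const_add y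
    · exact fun w hw => (tendsto_add_atTop_iff_nat 1).2 (htend y hy w hw)
  · exact hasDerivAt_smul_radialAverage (g := fun w => Q (w, Y y w))
      (hQ.comp (differentiableOn_id.prodMk (differentiableOn_slice hYd hy))
        fun w hw => ⟨hball1 hw, Set.mem_univ _⟩) hζ

end BriotBouquet

/-! ### The Painlevé system in rescaled variables -/

section Rescaling

open Metric

/-- `z (z - 1) ∂H/∂p` divided by `ζ ^ m`, in the variables given by `z = ζ ^ n`, `q = ζ ^ m u`,
`p = ζ ^ (-m) v`. -/
noncomputable def rescaledDerivP (κ : Fin 5 → ℂ) (n m : ℕ) (ζ u v : ℂ) : ℂ :=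
  2 * u * (ζ ^ m * u - 1) * (u - ζ ^ (n - m)) * v
    - (κ 1 * (ζ ^ m * u - 1) * (u - ζ ^ (n - m)) + (κ 2 - 1) * u * (ζ ^ m * u - 1)
      + κ 3 * ζ ^ m * u * (u - ζ ^ (n - m)))

/-- `z (z - 1) ∂H/∂q` multiplied by `ζ ^ m`, in the variables given by `z = ζ ^ n`, `q = ζ ^ m u`,
`p = ζ ^ (-m) v`. -/
noncomputable def rescaledDerivQ (κ : Fin 5 → ℂ) (n m : ℕ) (ζ u v : ℂ) : ℂ :=
  (3 * ζ ^ m * u ^ 2 - 2 * (1 + ζ ^ n) * u + ζ ^ (n - m)) * v ^ 2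
    - (κ 1 * (2 * ζ ^ m * u - 1 - ζ ^ n) + (κ 2 - 1) * (2 * ζ ^ m * u - 1)
      + κ 3 * (2 * ζ ^ m * u - ζ ^ n)) * v
    + κ 0 * (κ 0 + κ 4) * ζ ^ m

/-- The value of `u v` at `ζ = 0`. -/
noncomputable def leadingProduct (κ : Fin 5 → ℂ) (n m : ℕ) : ℂ :=
  (m + n * (κ 1 + κ 2 - 1)) / (2 * n)

/-- The holomorphic functions `f`, `g` such that, with `c` the leading product, the rescaled system
reads `ζ u' = 2 n u (u v - c) + ζ f(ζ, u, v)`, `ζ v' = - 2 n v (u v - c) + ζ g(ζ, u, v)`. Here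
`m = a + 1` and `n = a + b + 2`. -/
noncomputable def remainder (κ : Fin 5 → ℂ) (a b : ℕ) (ζ u v : ℂ) : ℂ × ℂ :=
  (((a + b + 2 : ℕ) * ((2 * u * v - κ 1) * (ζ ^ a * u ^ 2 + ζ ^ b - ζ ^ (a + b + 1) * u)
      - (κ 2 - 1) * ζ ^ a * u ^ 2 - κ 3 * ζ ^ a * u * (u - ζ ^ (b + 1))
      - (2 * u ^ 2 * v - (κ 1 + κ 2 - 1) * u) * ζ ^ (a + b + 1))) / (ζ ^ (a + b + 2) - 1),
   (-(a + b + 2 : ℕ) * ((3 * ζ ^ a * u ^ 2 - 2 * ζ ^ (a + b + 1) * u + ζ ^ b) * v ^ 2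
      - (κ 1 * (2 * ζ ^ a * u - ζ ^ (a + b + 1)) + (κ 2 - 1) * (2 * ζ ^ a * u)
        + κ 3 * (2 * ζ ^ a * u - ζ ^ (a + b + 1))) * v
      + κ 0 * (κ 0 + κ 4) * ζ ^ a
      - (2 * u * v ^ 2 - (κ 1 + κ 2 - 1) * v) * ζ ^ (a + b + 1))) / (ζ ^ (a + b + 2) - 1))

theorem pow_sub_one_ne_zero {n : ℕ} (hn : n ≠ 0) {ζ : ℂ} (hζ : ‖ζ‖ < 1) : ζ ^ n - 1 ≠ 0 := by
  intro h
  have : ‖ζ ^ n‖ = 1 := by rw [sub_eq_zero.1 h, norm_one]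
  rw [norm_pow] at this
  exact (pow_lt_one₀ (norm_nonneg ζ) hζ hn).ne this

theorem differentiableOn_remainder (κ : Fin 5 → ℂ) (a b : ℕ) :
    DifferentiableOn ℂ (fun x : ℂ × ℂ × ℂ => remainder κ a b x.1 x.2.1 x.2.2)
      (ball 0 1 ×ˢ Set.univ) := by
  have hne : ∀ x ∈ ball (0 : ℂ) 1 ×ˢ (Set.univ : Set (ℂ × ℂ)), x.1 ^ (a + b + 2) - 1 ≠ 0 :=
    fun x hx => pow_sub_one_ne_zero (by omega) (mem_ball_zero_iff.1 hx.1)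
  have hinv : DifferentiableOn ℂ (fun x : ℂ × ℂ × ℂ => (x.1 ^ (a + b + 2) - 1)⁻¹)
      (ball 0 1 ×ˢ Set.univ) := DifferentiableOn.inv (by fun_prop) hne
  simp only [remainder, div_eq_mul_inv]
  exact DifferentiableOn.prodMk (DifferentiableOn.mul (by fun_prop) hinv)
    (DifferentiableOn.mul (by fun_prop) hinv)

/-- The equation for `u`: at `ζ = 0` the right-hand side `n (z - 1)⁻¹ (⋯) - m u` reduces to
`2 n u (u v - c)`. -/
theorem rescaledDerivP_eq (κ : Fin 5 → ℂ) (a b : ℕ) {ζ : ℂ} (hζ : ‖ζ‖ < 1) (u v : ℂ) :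
    (a + b + 2 : ℕ) / (ζ ^ (a + b + 2) - 1) * rescaledDerivP κ (a + b + 2) (a + 1) ζ u v
      - (a + 1 : ℕ) * u =
    2 * (a + b + 2 : ℕ) * u * (u * v - leadingProduct κ (a + b + 2) (a + 1))
      + ζ * (remainder κ a b ζ u v).1 := by
  have h1 := pow_sub_one_ne_zero (n := a + b + 2) (by omega) hζ
  have h2 : ((a + b + 2 : ℕ) : ℂ) ≠ 0 := Nat.cast_ne_zero.2 (by omega)
  have h3 : a + b + 2 - (a + 1) = b + 1 := by omega
  simp only [rescaledDerivP, leadingProduct, remainder, h3]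
  generalize ((a + b + 2 : ℕ) : ℂ) = N at h2 ⊢
  field_simp
  ring

/-- The equation for `v`: at `ζ = 0` the right-hand side `m v - n (z - 1)⁻¹ (⋯)` reduces to
`- 2 n v (u v - c)`. -/
theorem rescaledDerivQ_eq (κ : Fin 5 → ℂ) (a b : ℕ) {ζ : ℂ} (hζ : ‖ζ‖ < 1) (u v : ℂ) :
    (a + 1 : ℕ) * v
      - (a + b + 2 : ℕ) / (ζ ^ (a + b + 2) - 1) * rescaledDerivQ κ (a + b + 2) (a + 1) ζ u v =
    -(2 * (a + b + 2 : ℕ) * v * (u * v - leadingProduct κ (a + b + 2) (a + 1)))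
      + ζ * (remainder κ a b ζ u v).2 := by
  have h1 := pow_sub_one_ne_zero (n := a + b + 2) (by omega) hζ
  have h2 : ((a + b + 2 : ℕ) : ℂ) ≠ 0 := Nat.cast_ne_zero.2 (by omega)
  have h3 : a + b + 2 - (a + 1) = b + 1 := by omega
  simp only [rescaledDerivQ, leadingProduct, remainder, h3]
  generalize ((a + b + 2 : ℕ) : ℂ) = N at h2 ⊢
  field_simp
  ring

/-- The rescaled system has, for every `t ≠ 0`, a solution `(u, v)` holomorphic at `ζ = 0` with
`u(0) = t`, and it depends holomorphically on `t`. -/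
theorem exists_rescaled_solution (κ : Fin 5 → ℂ) {n m : ℕ} (hm : 0 < m) (hmn : m < n) :
    ∃ u v : ℂ → ℂ → ℂ, ∀ t₀ : ℂ, t₀ ≠ 0 → ∃ ρ : ℝ, 0 < ρ ∧ ρ ≤ 1 ∧
      DifferentiableOn ℂ (fun x : ℂ × ℂ => u x.1 x.2) (ball t₀ ρ ×ˢ ball 0 ρ) ∧
      DifferentiableOn ℂ (fun x : ℂ × ℂ => v x.1 x.2) (ball t₀ ρ ×ˢ ball 0 ρ) ∧
      u t₀ 0 = t₀ ∧ v t₀ 0 = leadingProduct κ n m / t₀ ∧ ∀ ζ ∈ ball (0 : ℂ) ρ,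
        ζ * deriv (u t₀) ζ =
          n / (ζ ^ n - 1) * rescaledDerivP κ n m ζ (u t₀ ζ) (v t₀ ζ) - m * u t₀ ζ ∧
        ζ * deriv (v t₀) ζ =
          m * v t₀ ζ - n / (ζ ^ n - 1) * rescaledDerivQ κ n m ζ (u t₀ ζ) (v t₀ ζ) := by
  obtain ⟨a, rfl⟩ : ∃ a, m = a + 1 := ⟨m - 1, by omega⟩
  obtain ⟨b, rfl⟩ : ∃ b, n = a + b + 2 := ⟨n - a - 2, by omega⟩
  set N : ℂ := ((a + b + 2 : ℕ) : ℂ)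
  set c : ℂ := leadingProduct κ (a + b + 2) (a + 1)
  obtain ⟨f, hf_def⟩ : ∃ f : ℂ → ℂ × ℂ → ℂ, ∀ ζ y, f ζ y = (remainder κ a b ζ y.1 y.2).1 :=
    ⟨_, fun _ _ => rfl⟩
  obtain ⟨g, hg_def⟩ : ∃ g : ℂ → ℂ × ℂ → ℂ, ∀ ζ y, g ζ y = (remainder κ a b ζ y.1 y.2).2 :=
    ⟨_, fun _ _ => rfl⟩
  -- `X` stands for `(u v - c) / ζ`; in the equation for `(ζ X)'` the singular terms cancel
  let P : ℂ × (ℂ × ℂ) × ℂ → ℂ × ℂ := fun x =>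
    (2 * N * x.2.1.1 * x.2.2 + f x.1 x.2.1, -(2 * N * x.2.1.2 * x.2.2) + g x.1 x.2.1)
  let Q : ℂ × ℂ × ℂ → ℂ := fun x => f x.1 x.2 * x.2.2 + x.2.1 * g x.1 x.2
  have hrem := differentiableOn_remainder κ a b
  have hf : DifferentiableOn ℂ (fun x : ℂ × ℂ × ℂ => f x.1 x.2) (ball 0 1 ×ˢ Set.univ) := by
    simpa only [hf_def] using hrem.fst
  have hg : DifferentiableOn ℂ (fun x : ℂ × ℂ × ℂ => g x.1 x.2) (ball 0 1 ×ˢ Set.univ) := by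
    simpa only [hg_def] using hrem.snd
  have hP : DifferentiableOn ℂ P (ball 0 1 ×ˢ Set.univ) := by
    have hmaps : Set.MapsTo (fun x : ℂ × (ℂ × ℂ) × ℂ => (x.1, x.2.1))
        (ball 0 1 ×ˢ Set.univ) (ball 0 1 ×ˢ Set.univ) := fun x hx => ⟨hx.1, Set.mem_univ _⟩
    have hf' : DifferentiableOn ℂ (fun x : ℂ × (ℂ × ℂ) × ℂ => f x.1 x.2.1)
      (ball 0 1 ×ˢ Set.univ) := hf.comp (by fun_prop) hmaps
    have hg' : DifferentiableOn ℂ (fun x : ℂ × (ℂ × ℂ) × ℂ => g x.1 x.2.1)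
      (ball 0 1 ×ˢ Set.univ) := hg.comp (by fun_prop) hmaps
    exact DifferentiableOn.prodMk (DifferentiableOn.add (by fun_prop) hf')
      (DifferentiableOn.add (by fun_prop) hg')
  have hQ : DifferentiableOn ℂ Q (ball 0 1 ×ˢ Set.univ) :=
    (hf.mul (by fun_prop)).add (DifferentiableOn.mul (by fun_prop) hg)
  obtain ⟨Y, X, hYX⟩ := exists_holomorphic_flow hP hQ
  refine ⟨fun t ζ => (Y (t, c / t) ζ).1, fun t ζ => (Y (t, c / t) ζ).2, fun t₀ ht₀ => ?_⟩
  obtain ⟨ρ₁, hρ₁, hρ₁1, hYd, hXd, hsol⟩ := hYX (t₀, c / t₀)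
  have hini : ContinuousAt (fun t : ℂ => (t, c / t)) t₀ :=
    continuousAt_id.prodMk (continuousAt_const.div continuousAt_id ht₀)
  -- parameters close to `t₀` keep the initial value in the domain of the flow and avoid `0`
  obtain ⟨ρ₂, hρ₂, hsub⟩ := Metric.mem_nhds_iff.1
    (inter_mem (hini (ball_mem_nhds _ hρ₁)) (isOpen_ne.mem_nhds ht₀))
  have hρle : min ρ₁ ρ₂ ≤ ρ₁ := min_le_left _ _
  have hsub' : ∀ t ∈ ball t₀ (min ρ₁ ρ₂), (t, c / t) ∈ ball (t₀, c / t₀) ρ₁ ∧ t ≠ 0 :=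
    fun t ht => hsub (ball_subset_ball (min_le_right _ _) ht)
  have hYt : DifferentiableOn ℂ (fun x : ℂ × ℂ => Y (x.1, c / x.1) x.2)
      (ball t₀ (min ρ₁ ρ₂) ×ˢ ball 0 (min ρ₁ ρ₂)) := by
    refine hYd.comp (f := fun x : ℂ × ℂ => ((x.1, c / x.1), x.2)) ?_ fun x hx =>
      ⟨(hsub' x.1 hx.1).1, ball_subset_ball hρle hx.2⟩
    refine DifferentiableOn.prodMk (differentiableOn_fst.prodMk ?_) differentiableOn_snd
    simp only [div_eq_mul_inv]
    exact (differentiableOn_fst.inv fun x hx => (hsub' x.1 hx.1).2).const_mul c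
  obtain ⟨hY0, hode⟩ := hsol (t₀, c / t₀) (mem_ball_self hρ₁)
  refine ⟨min ρ₁ ρ₂, lt_min hρ₁ hρ₂, hρle.trans hρ₁1, hYt.fst, hYt.snd, by simp [hY0],
    by simp [hY0], fun ζ hζ => ?_⟩
  set y : ℂ → ℂ × ℂ := Y (t₀, c / t₀)
  set x : ℂ → ℂ := X (t₀, c / t₀)
  have hu : ∀ w ∈ ball (0 : ℂ) ρ₁,
      HasDerivAt (fun w => (y w).1) (2 * N * (y w).1 * x w + f w (y w)) w := fun w hw =>
    (hode w hw).1.fst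
  have hv : ∀ w ∈ ball (0 : ℂ) ρ₁,
      HasDerivAt (fun w => (y w).2) (-(2 * N * (y w).2 * x w) + g w (y w)) w := fun w hw =>
    (hode w hw).1.snd
  -- `u v - ζ X` is a first integral
  have hfirst : ∀ w ∈ ball (0 : ℂ) ρ₁, (y w).1 * (y w).2 - w • x w = c := by
    have hd : ∀ w ∈ ball (0 : ℂ) ρ₁,
        HasDerivAt (fun w => (y w).1 * (y w).2 - w • x w) 0 w := fun w hw => by
      refine (((hu w hw).mul (hv w hw)).sub (hode w hw).2).congr_deriv ?_
      simp only [Q]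
      ring
    intro w hw
    have := isOpen_ball.is_const_of_deriv_eq_zero (convex_ball (0 : ℂ) ρ₁).isPreconnected
      (fun w hw => (hd w hw).differentiableAt.differentiableWithinAt)
      (fun w hw => (hd w hw).deriv) hw (mem_ball_self hρ₁)
    rw [this, hY0]
    simp only [zero_smul, sub_zero]
    field_simp
  have hζ₁ : ζ ∈ ball (0 : ℂ) ρ₁ := ball_subset_ball hρle hζ
  have hζ1 : ‖ζ‖ < 1 := (mem_ball_zero_iff.1 hζ₁).trans_le hρ₁1
  have hI : (y ζ).1 * (y ζ).2 - c = ζ * x ζ := by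
    rw [← hfirst ζ hζ₁, smul_eq_mul]
    ring
  constructor
  · rw [(hu ζ hζ₁).deriv, rescaledDerivP_eq κ a b hζ1, hI, hf_def]
    ring
  · rw [(hv ζ hζ₁).deriv, rescaledDerivQ_eq κ a b hζ1, hI, hg_def]
    ring

end Rescaling

/-! ### From rescaled solutions to solutions of the Hamiltonian system -/

open Metric

section Hamiltonian

theorem deriv_hamiltonian_p (κ : Fin 5 → ℂ) (q p z : ℂ) :
    deriv (fun y => hamiltonian κ q y z) p =
      (2 * q * (q - 1) * (q - z) * p
        - (κ 1 * (q - 1) * (q - z) + (κ 2 - 1) * q * (q - 1) + κ 3 * q * (q - z)))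
        / (z * (z - 1)) := by
  unfold hamiltonian
  refine HasDerivAt.deriv (HasDerivAt.div_const ?_ _)
  have h := (hasDerivAt_pow 2 p).const_mul (q * (q - 1) * (q - z))
  have h' := (hasDerivAt_id p).const_mul
    (κ 1 * (q - 1) * (q - z) + (κ 2 - 1) * q * (q - 1) + κ 3 * q * (q - z))
  refine ((h.sub h').add_const (κ 0 * (κ 0 + κ 4) * (q - z))).congr_deriv ?_
  norm_num
  ring

theorem deriv_hamiltonian_q (κ : Fin 5 → ℂ) (q p z : ℂ) :
    deriv (fun x => hamiltonian κ x p z) q =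
      ((3 * q ^ 2 - 2 * (1 + z) * q + z) * p ^ 2
        - (κ 1 * (2 * q - 1 - z) + (κ 2 - 1) * (2 * q - 1) + κ 3 * (2 * q - z)) * p
        + κ 0 * (κ 0 + κ 4)) / (z * (z - 1)) := by
  unfold hamiltonian
  refine HasDerivAt.deriv (HasDerivAt.div_const ?_ _)
  have h0 := hasDerivAt_id' q
  have h1 := h0.sub_const 1
  have hz := h0.sub_const z
  have hA := ((h0.mul h1).mul hz).mul_const (p ^ 2)
  have hB := (((((h1.const_mul (κ 1)).mul hz).add ((h0.const_mul (κ 2 - 1)).mul h1)).add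
    ((h0.const_mul (κ 3)).mul hz)).mul_const p)
  refine ((hA.sub hB).add (hz.const_mul (κ 0 * (κ 0 + κ 4)))).congr_deriv ?_
  simp only [Pi.mul_apply]
  ring

theorem rescaledDerivP_eq_deriv (κ : Fin 5 → ℂ) {n m : ℕ} (hmn : m < n) {ζ : ℂ} (hζ : ζ ≠ 0)
    (u v : ℂ) :
    ζ ^ m * rescaledDerivP κ n m ζ u v / (ζ ^ n * (ζ ^ n - 1)) =
      deriv (fun y => hamiltonian κ (ζ ^ m * u) y (ζ ^ n)) (ζ ^ (-(m : ℤ)) * v) := by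
  obtain ⟨b, rfl⟩ : ∃ b, n = m + b := ⟨n - m, by omega⟩
  rw [deriv_hamiltonian_p, rescaledDerivP, Nat.add_sub_cancel_left, zpow_neg, zpow_natCast, pow_add]
  congr 1
  have : ζ ^ m ≠ 0 := pow_ne_zero _ hζ
  field_simp

theorem rescaledDerivQ_eq_deriv (κ : Fin 5 → ℂ) {n m : ℕ} (hmn : m < n) {ζ : ℂ} (hζ : ζ ≠ 0)
    (u v : ℂ) :
    ζ ^ (-(m : ℤ)) * rescaledDerivQ κ n m ζ u v / (ζ ^ n * (ζ ^ n - 1)) =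
      deriv (fun x => hamiltonian κ x (ζ ^ (-(m : ℤ)) * v) (ζ ^ n)) (ζ ^ m * u) := by
  obtain ⟨b, rfl⟩ : ∃ b, n = m + b := ⟨n - m, by omega⟩
  rw [deriv_hamiltonian_q, rescaledDerivQ, Nat.add_sub_cancel_left, zpow_neg, zpow_natCast, pow_add]
  congr 1
  have : ζ ^ m ≠ 0 := pow_ne_zero _ hζ
  field_simp

/-- The derivative of a branch `s` of the `n`-th root, from `n s ^ (n - 1) s' = 1`. -/
theorem hasDerivAt_root {n : ℕ} (hn : n ≠ 0) {U : Set ℂ} (hU : IsOpen U) {s : ℂ → ℂ}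
    (hs : DifferentiableOn ℂ s U) (hsn : ∀ z ∈ U, s z ^ n = z) {z : ℂ} (hz : z ∈ U)
    (hz0 : z ≠ 0) : HasDerivAt s (s z / (n * z)) z := by
  have hd := ((hs z hz).differentiableAt (hU.mem_nhds hz)).hasDerivAt
  have h1 : HasDerivAt (fun z => s z ^ n) 1 z :=
    (hasDerivAt_id z).congr_of_eventuallyEq (eventually_of_mem (hU.mem_nhds hz) hsn)
  have h2 := (hd.pow n).unique h1
  have hn' : (n : ℂ) ≠ 0 := Nat.cast_ne_zero.2 hn
  refine hd.congr_deriv ?_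
  have h3 : n * (s z ^ n) * deriv s z = s z := by
    rw [← Nat.sub_add_cancel (Nat.one_le_iff_ne_zero.2 hn), pow_succ,
      Nat.sub_add_cancel (Nat.one_le_iff_ne_zero.2 hn)]
    linear_combination s z * h2
  rw [hsn z hz] at h3
  rw [eq_div_iff (mul_ne_zero hn' hz0)]
  linear_combination h3

/-- The lift `ζ ↦ (ζ ^ m u(ζ), ζ ^ (-m) v(ζ))` of the solution given by rescaled variables. -/
noncomputable def liftOf (m : ℕ) (u v : ℂ → ℂ) (ζ : ℂ) : ℂ × ℂ :=
  (ζ ^ m * u ζ, ζ ^ (-(m : ℤ)) * v ζ)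

/-- A solution of the rescaled system, composed with any branch of `z ^ (1 / n)`, solves the Hamiltonian
system; the derivative of the factor `ζ ^ (± m)` absorbs the terms `m u` and `m v`. -/
theorem isSolutionOn_liftOf (κ : Fin 5 → ℂ) {n m : ℕ} (hmn : m < n) {ρ : ℝ} (hρ0 : 0 ≤ ρ)
    (hρ1 : ρ ≤ 1) {u v : ℂ → ℂ} (hu : DifferentiableOn ℂ u (ball 0 ρ))
    (hv : DifferentiableOn ℂ v (ball 0 ρ))
    (hode : ∀ ζ ∈ ball (0 : ℂ) ρ,
      ζ * deriv u ζ = n / (ζ ^ n - 1) * rescaledDerivP κ n m ζ (u ζ) (v ζ) - m * u ζ ∧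
      ζ * deriv v ζ = m * v ζ - n / (ζ ^ n - 1) * rescaledDerivQ κ n m ζ (u ζ) (v ζ))
    {U : Set ℂ} (hU : IsOpen U) (hUr : ∀ z ∈ U, 0 < ‖z‖ ∧ ‖z‖ < ρ ^ n) {s : ℂ → ℂ}
    (hs : DifferentiableOn ℂ s U) (hsn : ∀ z ∈ U, s z ^ n = z) :
    IsSolutionOn κ U (fun z => (liftOf m u v (s z)).1) (fun z => (liftOf m u v (s z)).2) := by
  intro z hz
  have hn : n ≠ 0 := by omega
  have hn' : (n : ℂ) ≠ 0 := Nat.cast_ne_zero.2 hn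
  obtain ⟨hz0, hzr⟩ := hUr z hz
  have hz0' : z ≠ 0 := norm_pos_iff.1 hz0
  have hds := hasDerivAt_root hn hU hs hsn hz hz0'
  have hszn := hsn z hz
  set ζ := s z with hζ_def
  have hζ0 : ζ ≠ 0 := by
    rintro h
    rw [h, zero_pow hn] at hszn
    exact hz0' hszn.symm
  have hζρ : ζ ∈ ball (0 : ℂ) ρ := by
    rw [mem_ball_zero_iff]
    refine lt_of_pow_lt_pow_left₀ n hρ0 ?_
    rwa [← norm_pow, hszn]
  have hζ1 : ζ ^ n - 1 ≠ 0 :=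
    pow_sub_one_ne_zero hn ((mem_ball_zero_iff.1 hζρ).trans_le hρ1)
  have hdu := ((hu ζ hζρ).differentiableAt (isOpen_ball.mem_nhds hζρ)).hasDerivAt
  have hdv := ((hv ζ hζρ).differentiableAt (isOpen_ball.mem_nhds hζρ)).hasDerivAt
  obtain ⟨hou, hov⟩ := hode ζ hζρ
  have hP := rescaledDerivP_eq_deriv κ hmn hζ0 (u ζ) (v ζ)
  have hQ := rescaledDerivQ_eq_deriv κ hmn hζ0 (u ζ) (v ζ)
  simp only [liftOf, ← hζ_def]
  rw [hszn] at hP hQ hou hov hζ1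
  rw [← hP, ← hQ]
  have hpow : ∀ k : ℤ, HasDerivAt (fun w : ℂ => w ^ k) (k * ζ ^ k / ζ) ζ := fun k =>
    (hasDerivAt_zpow k ζ (Or.inl hζ0)).congr_deriv (by rw [zpow_sub_one₀ hζ0]; ring)
  constructor
  · have h1 := ((hpow m).mul hdu).comp z hds
    simp only [zpow_natCast] at h1
    refine h1.congr_deriv ?_
    have h2 : deriv u ζ = (n / (z - 1) * rescaledDerivP κ n m ζ (u ζ) (v ζ) - m * u ζ) / ζ := by
      rw [eq_div_iff hζ0, ← hou, mul_comm]
    rw [h2]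
    push_cast
    field_simp
    ring
  · refine (((hpow (-m)).mul hdv).comp z hds).congr_deriv ?_
    have h2 : deriv v ζ = (m * v ζ - n / (z - 1) * rescaledDerivQ κ n m ζ (u ζ) (v ζ)) / ζ := by
      rw [eq_div_iff hζ0, ← hov, mul_comm]
    rw [h2]
    push_cast
    generalize ζ ^ (-(m : ℤ)) = w
    field_simp
    ring

end Hamiltonian

/-! ### Leading coefficients and branches -/

section Branches

/-- A punctured germ at `0` determines its order of vanishing and its leading coefficient. -/
theorem eq_of_pow_mul_eventuallyEq {i j : ℕ} {φ ψ : ℂ → ℂ} (hφ : ContinuousAt φ 0)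
    (hψ : ContinuousAt ψ 0) (hφ0 : φ 0 ≠ 0) (hψ0 : ψ 0 ≠ 0)
    (h : (fun ζ => ζ ^ i * φ ζ) =ᶠ[𝓝[≠] (0 : ℂ)] fun ζ => ζ ^ j * ψ ζ) :
    i = j ∧ φ 0 = ψ 0 := by
  wlog hij : i ≤ j generalizing i j φ ψ
  · exact (this hψ hφ hψ0 hφ0 h.symm (le_of_not_ge hij)).imp Eq.symm Eq.symm
  obtain ⟨d, rfl⟩ := Nat.exists_eq_add_of_le hij
  have h' : φ =ᶠ[𝓝[≠] (0 : ℂ)] fun ζ => ζ ^ d * ψ ζ := by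
    filter_upwards [h, self_mem_nhdsWithin] with ζ hζ hζ0
    rw [pow_add, mul_assoc] at hζ
    exact mul_left_cancel₀ (pow_ne_zero i hζ0) hζ
  have hc : ContinuousAt (fun ζ : ℂ => ζ ^ d * ψ ζ) 0 := by fun_prop
  have h0 : φ 0 = 0 ^ d * ψ 0 := tendsto_nhds_unique
    ((hφ.tendsto.mono_left nhdsWithin_le_nhds).congr' h')
    (hc.tendsto.mono_left nhdsWithin_le_nhds)
  rcases Nat.eq_zero_or_pos d with rfl | hd
  · simpa using h0
  · rw [zero_pow hd.ne', zero_mul] at h0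
    exact absurd h0 hφ0

/-- Two branches of lifts that coincide as germs have the same order of vanishing and the same
leading coefficient. -/
theorem eq_of_branchGerm_eq {n m m' j j' : ℕ} {u u' v v' : ℂ → ℂ} (hu : ContinuousAt u 0)
    (hu' : ContinuousAt u' 0) (hu0 : u 0 ≠ 0) (hu'0 : u' 0 ≠ 0)
    (h : branchGerm n j (liftOf m u v) = branchGerm n j' (liftOf m' u' v')) :
    m = m' ∧ turn n j 1 ^ m * u 0 = turn n j' 1 ^ m' * u' 0 := by
  have hturn : ∀ k ζ, turn n k ζ = turn n k 1 * ζ := fun k ζ => by simp [turn]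
  have hne : ∀ k, turn n k 1 ≠ 0 := fun k => by simp [turn, Complex.exp_ne_zero]
  have hcont : ∀ k {φ : ℂ → ℂ} (i : ℕ), ContinuousAt φ 0 →
      ContinuousAt (fun ζ => turn n k 1 ^ i * φ (turn n k 1 * ζ)) 0 := fun k φ i hφ =>
    continuousAt_const.mul (ContinuousAt.comp (g := φ) (f := fun ζ => turn n k 1 * ζ)
      (by simpa using hφ) (by fun_prop))
  have h1 := Germ.coe_eq.1 h
  have h2 := eq_of_pow_mul_eventuallyEq (i := m) (j := m') (hcont j m hu) (hcont j' m' hu')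
    (mul_ne_zero (pow_ne_zero _ (hne j)) (by simpa using hu0))
    (mul_ne_zero (pow_ne_zero _ (hne j')) (by simpa using hu'0)) (by
      filter_upwards [h1] with ζ hζ
      have := congrArg Prod.fst hζ
      simp only [liftOf] at this
      rw [hturn j, hturn j', mul_pow, mul_pow] at this
      linear_combination this)
  simpa using h2

theorem turn_one_pow_ne_one {n m j : ℕ} (hmn : Nat.Coprime m n) (hj : 0 < j) (hjn : j < n) :
    turn n j 1 ^ m ≠ 1 := by
  have hn : n ≠ 0 := by omega
  have h := Complex.isPrimitiveRoot_exp n hn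
  have : turn n j 1 = Complex.exp (2 * Real.pi * Complex.I / n) ^ j := by
    rw [turn, mul_one, ← Complex.exp_nat_mul]
    congr 1
    ring
  rw [this, ← pow_mul]
  intro h1
  exact Nat.not_dvd_of_pos_of_lt hj hjn
    (hmn.symm.dvd_of_dvd_mul_right (h.dvd_of_pow_eq_one _ h1))

/-- A solution of the rescaled system with `u(0) ≠ 0` gives a solution germ with exactly `n` branches
when `m` is coprime to `n`. -/
theorem isBranchSolutionGerm_liftOf (κ : Fin 5 → ℂ) {n m : ℕ} (hmn : m < n)
    (hco : Nat.Coprime m n) {ρ : ℝ} (hρ : 0 < ρ) (hρ1 : ρ ≤ 1) {u v : ℂ → ℂ}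
    (hu : DifferentiableOn ℂ u (ball 0 ρ)) (hv : DifferentiableOn ℂ v (ball 0 ρ)) (hu0 : u 0 ≠ 0)
    (hode : ∀ ζ ∈ ball (0 : ℂ) ρ,
      ζ * deriv u ζ = n / (ζ ^ n - 1) * rescaledDerivP κ n m ζ (u ζ) (v ζ) - m * u ζ ∧
      ζ * deriv v ζ = m * v ζ - n / (ζ ^ n - 1) * rescaledDerivQ κ n m ζ (u ζ) (v ζ)) :
    IsBranchSolutionGerm κ n (liftOf m u v) := by
  have hmem : ball (0 : ℂ) ρ ∈ 𝓝 0 := ball_mem_nhds 0 hρ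
  have hua := hu.analyticAt hmem
  have hva := hv.analyticAt hmem
  have hid : MeromorphicAt (fun ζ : ℂ => ζ) 0 := MeromorphicAt.id 0
  refine ⟨(hid.pow m).mul hua.meromorphicAt, (hid.zpow (-m)).mul hva.meromorphicAt,
    ⟨ρ ^ n, by positivity, pow_le_one₀ hρ.le hρ1, fun U hU hUr s hs hsn =>
      isSolutionOn_liftOf κ hmn hρ.le hρ1 hu hv hode hU hUr hs hsn⟩, fun j hj hjn h => ?_⟩
  have h1 := (eq_of_branchGerm_eq hua.continuousAt hua.continuousAt hu0 hu0 h).2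
  have h2 : turn n 0 1 = 1 := by simp [turn]
  rw [h2, one_pow] at h1
  exact turn_one_pow_ne_one hco hj hjn (mul_right_cancel₀ hu0 h1)

end Branches

/-! ### Taylor expansions -/

section Expansions

/-- The `k`-th Taylor coefficient of `f` at `0`. -/
noncomputable def taylorCoeffZero (f : ℂ → ℂ) (k : ℕ) : ℂ :=
  (k.factorial : ℂ)⁻¹ * iteratedDeriv k f 0

theorem hasSum_taylorCoeffZero_succ {f : ℂ → ℂ} {ρ : ℝ} (hf : DifferentiableOn ℂ f (ball 0 ρ))
    {ζ : ℂ} (hζ : ζ ∈ ball (0 : ℂ) ρ) :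
    HasSum (fun k : ℕ => taylorCoeffZero f (k + 1) * ζ ^ (k + 1)) (f ζ - f 0) := by
  have h := Complex.hasSum_taylorSeries_on_ball hf hζ
  have h1 : HasSum (fun k : ℕ => taylorCoeffZero f k * ζ ^ k) (f ζ) := by
    refine h.congr_fun fun k => ?_
    simp only [taylorCoeffZero, smul_eq_mul, sub_zero]
    ring
  have h2 := (hasSum_nat_add_iff' 1).2 h1
  simpa [taylorCoeffZero] using h2

end Expansions

/-! ### The index set -/

theorem card_branchIndices {n : ℕ} (hn : 1 < n) : (branchIndices n).card = Nat.totient n := by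
  rw [branchIndices, Nat.totient_eq_card_coprime]
  congr 1
  ext m
  simp only [Finset.mem_filter, Finset.mem_Ioo, Finset.mem_range, Nat.coprime_comm (m := m)]
  refine ⟨fun h => ⟨h.1.2, h.2⟩, fun h => ⟨⟨Nat.pos_of_ne_zero ?_, h.1⟩, h.2⟩⟩
  rintro rfl
  exact hn.ne' ((Nat.coprime_zero_left n).1 h.2)

end PainleveVI

open PainleveVI in
theorem mainTheorem8 (n : ℕ) (hn : 1 < n) (κ : Fin 5 → ℂ) (hκ : κ ∈ parameterSpace) :
    (branchIndices n).card = Nat.totient n ∧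
    ∃ F : ℕ → ℂ → ℂ → ℂ × ℂ,
      -- each `m` gives a one-parameter family of `n`-branch solution germs
      (∀ m ∈ branchIndices n, IsOneParameterFamily n (F m) ∧
        ∀ t : ℂ, t ≠ 0 → IsBranchSolutionGerm κ n (F m t)) ∧
      -- the families are mutually disjoint
      (∀ m ∈ branchIndices n, ∀ m' ∈ branchIndices n, m ≠ m' →
        Disjoint (familyGerms n (F m)) (familyGerms n (F m'))) ∧
      -- convergent Puiseux expansions, in the variable `ζ` with `ζ ^ n = z`
      (∃ (a : ℕ → ℂ → ℕ → ℂ) (b : ℕ → ℂ → ℤ → ℂ),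
        ∀ m ∈ branchIndices n, ∀ t : ℂ, t ≠ 0 → ∃ ρ : ℝ, 0 < ρ ∧
          ∀ ζ : ℂ, 0 < ‖ζ‖ → ‖ζ‖ < ρ →
            HasSum (fun k : ℕ => a m t (m + 1 + k) * ζ ^ (m + 1 + k))
              ((F m t ζ).1 - t * ζ ^ m) ∧
            HasSum (fun k : ℕ => b m t (-(m : ℤ) + 1 + k) * ζ ^ (-(m : ℤ) + 1 + k))
              ((F m t ζ).2 - (m + n * (κ 1 + κ 2 - 1)) / (2 * n * t) * ζ ^ (-(m : ℤ)))) := by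
  refine ⟨card_branchIndices hn, ?_⟩
  have hidx : ∀ m ∈ branchIndices n, (0 < m ∧ m < n) ∧ Nat.Coprime m n := fun m hm => by
    simpa [branchIndices] using hm
  have hex := fun m (hm : m ∈ branchIndices n) =>
    exists_rescaled_solution κ (hidx m hm).1.1 (hidx m hm).1.2
  choose! u v huv using hex
  have hslice : ∀ m ∈ branchIndices n, ∀ t : ℂ, t ≠ 0 → ∃ ρ : ℝ, 0 < ρ ∧ ρ ≤ 1 ∧
      DifferentiableOn ℂ (u m t) (Metric.ball 0 ρ) ∧
      DifferentiableOn ℂ (v m t) (Metric.ball 0 ρ) ∧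
      IsBranchSolutionGerm κ n (liftOf m (u m t) (v m t)) := fun m hm t ht => by
    obtain ⟨ρ, hρ, hρ1, hu, hv, hu0, -, hode⟩ := huv m hm t ht
    have hu' := differentiableOn_slice hu (Metric.mem_ball_self hρ)
    have hv' := differentiableOn_slice hv (Metric.mem_ball_self hρ)
    exact ⟨ρ, hρ, hρ1, hu', hv', isBranchSolutionGerm_liftOf κ (hidx m hm).1.2 (hidx m hm).2
      hρ hρ1 hu' hv' (by rwa [hu0]) hode⟩
  have hcont : ∀ m ∈ branchIndices n, ∀ t : ℂ, t ≠ 0 → ContinuousAt (u m t) 0 ∧ u m t 0 = t :=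
    fun m hm t ht => by
      obtain ⟨ρ, hρ, -, hu, -⟩ := hslice m hm t ht
      obtain ⟨-, -, -, -, -, hu0, -⟩ := huv m hm t ht
      exact ⟨(hu.analyticAt (Metric.ball_mem_nhds 0 hρ)).continuousAt, hu0⟩
  -- the coefficient of `ζ ^ k` in `q` and `p` is the Taylor coefficient of `u` of index `k - m`
  -- and of `v` of index `k + m`
  refine ⟨fun m t => liftOf m (u m t) (v m t), fun m hm => ⟨⟨?_, fun t₀ ht₀ => ?_⟩,
    fun t ht => ?_⟩, fun m hm m' hm' hne => ?_, fun m t k => taylorCoeffZero (u m t) (k - m),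
    fun m t k => taylorCoeffZero (v m t) (k + m).toNat, fun m hm t ht => ?_⟩
  · intro t ht t' ht' h
    obtain ⟨hc, h0⟩ := hcont m hm t ht
    obtain ⟨hc', h0'⟩ := hcont m hm t' ht'
    have := (eq_of_branchGerm_eq hc hc' (by rwa [h0]) (by rwa [h0']) h).2
    simpa [turn, h0, h0'] using this
  · obtain ⟨ρ, hρ, -, hu, hv, -⟩ := huv m hm t₀ ht₀
    refine ⟨ρ, hρ, ?_⟩
    have hsub : {x : ℂ × ℂ | ‖x.1 - t₀‖ < ρ ∧ 0 < ‖x.2‖ ∧ ‖x.2‖ < ρ} ⊆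
        Metric.ball t₀ ρ ×ˢ Metric.ball 0 ρ := fun x hx =>
      ⟨mem_ball_iff_norm.2 hx.1, mem_ball_zero_iff.2 hx.2.2⟩
    refine DifferentiableOn.prodMk ((differentiableOn_snd.pow m).mul (hu.mono hsub))
      (DifferentiableOn.mul ?_ (hv.mono hsub))
    intro x hx
    exact ((differentiableAt_zpow.2 (Or.inl (norm_pos_iff.1 hx.2.1))).comp x
      differentiableAt_snd).differentiableWithinAt
  · obtain ⟨-, -, -, -, -, h⟩ := hslice m hm t ht
    exact h
  · rw [Set.disjoint_left]
    rintro _ ⟨t, ht, j, rfl⟩ ⟨t', ht', j', h⟩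
    obtain ⟨hc, h0⟩ := hcont m hm t ht
    obtain ⟨hc', h0'⟩ := hcont m' hm' t' ht'
    exact hne (eq_of_branchGerm_eq hc hc' (by rwa [h0]) (by rwa [h0']) h).1
  · obtain ⟨ρ, hρ, -, hu, hv, -⟩ := hslice m hm t ht
    obtain ⟨-, -, -, -, -, hu0, hv0, -⟩ := huv m hm t ht
    refine ⟨ρ, hρ, fun ζ hζ0 hζ => ⟨?_, ?_⟩⟩
    · have h := (hasSum_taylorCoeffZero_succ hu (mem_ball_zero_iff.2 hζ)).mul_left (ζ ^ m)
      rw [hu0, mul_sub, mul_comm (ζ ^ m) t] at h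
      refine h.congr_fun fun k => ?_
      beta_reduce
      rw [show m + 1 + k - m = k + 1 by omega, add_assoc m, pow_add, add_comm 1 k]
      ring
    · have hζ' : ζ ≠ 0 := norm_pos_iff.1 hζ0
      have h := (hasSum_taylorCoeffZero_succ hv (mem_ball_zero_iff.2 hζ)).mul_left
        (ζ ^ (-(m : ℤ)))
      have hlead : v m t 0 = (m + n * (κ 1 + κ 2 - 1)) / (2 * n * t) := by
        rw [hv0, leadingProduct, div_div]
      rw [mul_sub, hlead, mul_comm _ (_ / _)] at h
      refine h.congr_fun fun k => ?_
      beta_reduce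
      rw [show (-(m : ℤ) + 1 + k + m).toNat = k + 1 by omega,
        show -(m : ℤ) + 1 + k = -m + ((k + 1 : ℕ) : ℤ) by push_cast; ring, zpow_add₀ hζ',
        zpow_natCast]
      ring
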